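/- A *cyclotomic generating function* (CGF) is a nonzero polynomial $f(q)=\sum_{k} c_k q^k$ with nonnegative integer coefficients all of whose complex roots are either zero or roots of unity. A random variable *corresponds to* $f$ if it takes the value $k$ with probability $c_k/f(1)$ for each integer $k\ge 0$. For a random variable $\mathcal{Y}$ with mean $\mu$ and variance $\sigma^2$, let $\mathcal{Y}^*=(\mathcal{Y}-\mu)/\sigma$ be the standardized random variable, with the convention $\mathcal{Y}^*=0$ if $\sigma=0$, and let $\mu_d^{\mathcal{Y}}=\mathbb{E}[\mathcal{Y}^d]$ be the $d$th moment. A real random variable is *determined by its moments* if its moments of all orders exist and are finite, and every real random variable with the same finite moments has the same distribution. **Theorem.** Suppose $\mathcal{X}_1,\mathcal{X}_2,\ldots$ is a sequence of random variables corresponding to cyclotomic generating functions such that $\mathcal{X}_n^*$ converges in distribution to $\mathcal{X}$ for some real-valued random variable $\mathcal{X}$. Then $\mathcal{X}$ is determined by its moments and, for every integer $d\ge 1$, $$\lim_{n\to\infty}\mu_d^{\mathcal{X}_n^*}=\mu_d^{\mathcal{X}}.$$ -/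

import Mathlib

open MeasureTheory ProbabilityTheory Filter Topology Polynomial

/-- A cyclotomic generating function: a nonzero polynomial with nonnegative integer coefficients
whose complex roots are all either zero or roots of unity. -/
def IsCyclotomicGeneratingFunction (f : ℕ[X]) : Prop :=
  f ≠ 0 ∧ ∀ z : ℂ, aeval z f = 0 → z = 0 ∨ ∃ m : ℕ, 0 < m ∧ z ^ m = 1

/-- The real random variable `Y` on the probability space `(Ω, μ)` corresponds to the polynomial
`f = ∑ c_k q^k`: it satisfies `P(Y = k) = c_k / f(1)` for every natural number `k`. (These
probabilities add up to one, so `Y` is almost surely a natural number.) -/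
def CorrespondsTo {Ω : Type*} [MeasurableSpace Ω] (Y : Ω → ℝ) (f : ℕ[X]) (μ : Measure Ω) : Prop :=
  AEMeasurable Y μ ∧ ∀ k : ℕ, μ.real {ω | Y ω = (k : ℝ)} = (f.coeff k : ℝ) / (f.eval 1 : ℕ)

/-- The standardization `(Y - E Y) / σ`, where `σ` is the standard deviation of `Y`. When `σ = 0`,
it is the zero random variable. -/
noncomputable def standardize {Ω : Type*} [MeasurableSpace Ω] (Y : Ω → ℝ) (μ : Measure Ω) :
    Ω → ℝ :=
  fun ω ↦ (Y ω - ∫ ω', Y ω' ∂μ) / √(variance Y μ)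

/-- `Y` is determined by its moments: it has finite moments of all orders, and every probability
measure on the real line with the same finite moments is the law of `Y`. -/
def IsDeterminedByMoments {Ω : Type*} [MeasurableSpace Ω] (Y : Ω → ℝ) (μ : Measure Ω) : Prop :=
  (∀ d : ℕ, Integrable (fun ω ↦ Y ω ^ d) μ) ∧
    ∀ ν : Measure ℝ, IsProbabilityMeasure ν →
      (∀ d : ℕ, Integrable (fun x : ℝ ↦ x ^ d) ν ∧ ∫ x : ℝ, x ^ d ∂ν = moment Y d μ) →
      ν = μ.map Y

/-! Everything rests on a bound, uniform in `n`, for the moment generating functions of the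
standardized variables. The nonzero roots `z` of `f` lie on the unit circle and differ from 1, so
the squared centered generating function at `e ^ s` is a product of factors `1 + w * sinh (s / 2) ^
2` with `w = 4 / ‖1 - z‖ ^ 2 ≥ 1`, and the variance is `(∑ w) / 4`. Now `1 + x ≤ e ^ x` bounds the
centered generating function through the variance alone, and a nonzero variance is at least `1 / 4`,
so rescaling gives a bound depending only on `t` (`CorrespondsTo.standardize_mgf`). The weak limit
inherits the bound (`integrable_exp_of_tendsto`), so its moments determine it
(`eq_of_moments_eq_of_integrable_exp`); truncation gives convergence of moments
(`tendsto_integral_pow_of_tendsto`). -/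

/-! ### Moment determinacy from exponential moments -/

/-- Power series expansion of the complex moment generating function in terms of moments. -/
lemma hasSum_complexMGF_of_integrable_exp {μ : Measure ℝ}
    (h : ∀ t : ℝ, Integrable (fun x ↦ Real.exp (t * x)) μ) (z : ℂ) :
    HasSum (fun k : ℕ ↦ z ^ k / (k.factorial : ℂ) * ((∫ x, x ^ k ∂μ : ℝ) : ℂ))
      (complexMGF id μ z) := by
  have key := hasSum_integral_of_dominated_convergence (μ := μ)
    (F := fun (k : ℕ) (x : ℝ) ↦ (z * x) ^ k / (k.factorial : ℂ))
    (f := fun x : ℝ ↦ Complex.exp (z * x))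
    (fun (k : ℕ) x ↦ (‖z‖ * |x|) ^ k / (k.factorial : ℝ))
    (fun k ↦ by fun_prop)
    (fun k ↦ .of_forall fun x ↦ by simp [mul_pow])
    (.of_forall fun x ↦ Real.summable_pow_div_factorial _)
    (by
      have := integrable_exp_mul_abs (X := id) (h ‖z‖) (h (-‖z‖))
      refine this.congr (.of_forall fun x ↦ ?_)
      simp [Real.exp_eq_exp_ℝ, NormedSpace.exp_eq_tsum_div])
    (.of_forall fun x ↦ by
      rw [Complex.exp_eq_exp_ℂ]
      exact NormedSpace.expSeries_div_hasSum_exp _)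
  convert! key using 2 with k
  rw [← integral_complex_ofReal, ← integral_const_mul]
  congr 1 with x
  push_cast
  ring

/-- The integral of `cosh (t * x)` as a series in the even moments. -/
lemma lintegral_cosh_eq_tsum {μ : Measure ℝ} (h : ∀ d : ℕ, Integrable (fun x : ℝ ↦ x ^ d) μ)
    (t : ℝ) :
    ∫⁻ x, ENNReal.ofReal (Real.cosh (t * x)) ∂μ =
      ∑' k : ℕ, ENNReal.ofReal (t ^ (2 * k) / (2 * k).factorial * ∫ x, x ^ (2 * k) ∂μ) := by
  have h1 (x : ℝ) : ENNReal.ofReal (Real.cosh (t * x)) =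
      ∑' k : ℕ, ENNReal.ofReal (t ^ (2 * k) / (2 * k).factorial * x ^ (2 * k)) := by
    rw [Real.cosh_eq_tsum, ENNReal.ofReal_tsum_of_nonneg]
    · congr 1 with k
      congr 1
      ring
    · intro k
      have := (even_two_mul k).pow_nonneg (t * x)
      positivity
    · exact (Real.hasSum_cosh _).summable
  simp_rw [h1]
  rw [lintegral_tsum fun k ↦ by fun_prop]
  congr 1 with k
  rw [← integral_const_mul, ofReal_integral_eq_lintegral_ofReal ((h _).const_mul _)]
  refine .of_forall fun x ↦ ?_
  have h1 := (even_two_mul k).pow_nonneg t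
  have h2 := (even_two_mul k).pow_nonneg x
  simp only [Pi.zero_apply]
  positivity

lemma integrable_cosh_of_integrable_exp {μ : Measure ℝ}
    (h : ∀ t : ℝ, Integrable (fun x ↦ Real.exp (t * x)) μ) (t : ℝ) :
    Integrable (fun x ↦ Real.cosh (t * x)) μ := by
  refine (((h t).add (h (-t))).div_const 2).congr (.of_forall fun x ↦ ?_)
  simp [Real.cosh_eq]

lemma integrable_pow_of_integrable_exp {μ : Measure ℝ}
    (h : ∀ t : ℝ, Integrable (fun x ↦ Real.exp (t * x)) μ) (d : ℕ) :
    Integrable (fun x : ℝ ↦ x ^ d) μ :=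
  integrable_pow_of_integrable_exp_mul (X := id) one_ne_zero (h 1) (h (-1)) d

/-- A measure whose moment generating function is finite everywhere is the only one with its
moments. -/
lemma eq_of_moments_eq_of_integrable_exp {μ ν : Measure ℝ} [IsFiniteMeasure μ] [IsFiniteMeasure ν]
    (h : ∀ t : ℝ, Integrable (fun x ↦ Real.exp (t * x)) μ)
    (hν : ∀ d : ℕ, Integrable (fun x : ℝ ↦ x ^ d) ν)
    (hm : ∀ d : ℕ, ∫ x, x ^ d ∂ν = ∫ x, x ^ d ∂μ) : ν = μ := by
  -- Only moments of `ν` are known. The `cosh` series has nonnegative terms and even moments only,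
  -- so Tonelli transfers finiteness from `μ`.
  have h' : ∀ t : ℝ, Integrable (fun x ↦ Real.exp (t * x)) ν := by
    intro t
    have hc : Integrable (fun x ↦ Real.cosh (t * x)) ν := by
      refine ⟨by fun_prop, ?_⟩
      rw [hasFiniteIntegral_iff_ofReal (.of_forall fun x ↦ (Real.cosh_pos _).le),
        lintegral_cosh_eq_tsum hν]
      simp_rw [hm]
      rw [← lintegral_cosh_eq_tsum (integrable_pow_of_integrable_exp h)]
      exact (integrable_cosh_of_integrable_exp h t).lintegral_lt_top
    refine (hc.const_mul 2).mono (by fun_prop) (.of_forall fun x ↦ ?_)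
    rw [Real.norm_of_nonneg (Real.exp_pos _).le,
      Real.norm_of_nonneg (by have := Real.cosh_pos (t * x); positivity), Real.cosh_eq]
    linarith [Real.exp_pos (-(t * x))]
  refine Measure.ext_of_complexMGF_id_eq (funext fun z ↦ ?_)
  have h1 := hasSum_complexMGF_of_integrable_exp h' z
  simp_rw [hm] at h1
  exact h1.unique (hasSum_complexMGF_of_integrable_exp h z)

/-! ### Weak limits under uniform exponential bounds -/

/-- Uniform bounds on moment generating functions pass to weak limits. -/
lemma integrable_exp_of_tendsto {μs : ℕ → ProbabilityMeasure ℝ} {μ : ProbabilityMeasure ℝ}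
    (hμ : Tendsto μs atTop (𝓝 μ)) {C : ℝ → ℝ}
    (hint : ∀ n t, Integrable (fun x ↦ Real.exp (t * x)) (μs n : Measure ℝ))
    (hC : ∀ n t, ∫ x, Real.exp (t * x) ∂(μs n : Measure ℝ) ≤ C t) (t : ℝ) :
    Integrable (fun x ↦ Real.exp (t * x)) (μ : Measure ℝ) ∧
      ∫ x, Real.exp (t * x) ∂(μ : Measure ℝ) ≤ C t := by
  have hC0 : 0 ≤ C t := (integral_nonneg fun x ↦ (Real.exp_pos _).le).trans (hC 0 t)
  have hle : ∫⁻ x, ENNReal.ofReal (Real.exp (t * x)) ∂(μ : Measure ℝ) ≤ ENNReal.ofReal (C t) := by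
    -- Fatou's inequality for weak convergence: nonnegativity and continuity suffice, although `exp`
    -- is unbounded.
    refine (lintegral_le_liminf_lintegral_of_forall_isOpen_measure_le_liminf_measure
      (μs := fun n ↦ (μs n : Measure ℝ)) (by fun_prop) (fun x ↦ (Real.exp_pos _).le)
      fun G hG ↦ ProbabilityMeasure.le_liminf_measure_open_of_tendsto hμ hG).trans ?_
    refine liminf_le_of_le (by isBoundedDefault) fun b hb ↦ ?_
    obtain ⟨n, hn⟩ := hb.exists
    refine hn.trans ?_
    rw [← ofReal_integral_eq_lintegral_ofReal (hint n t) (.of_forall fun x ↦ (Real.exp_pos _).le)]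
    exact ENNReal.ofReal_le_ofReal (hC n t)
  refine ⟨⟨by fun_prop, ?_⟩, ?_⟩
  · rw [hasFiniteIntegral_iff_ofReal (.of_forall fun x ↦ (Real.exp_pos _).le)]
    exact hle.trans_lt ENNReal.ofReal_lt_top
  · rw [integral_eq_lintegral_of_nonneg_ae (.of_forall fun x ↦ (Real.exp_pos _).le) (by fun_prop)]
    exact ENNReal.toReal_le_of_le_ofReal hC0 hle

/-- Truncation changes nothing for `|x| ≤ K`; beyond that, `K ≤ |x| ^ d` pays for the factor `1 /
K`. -/
lemma abs_pow_sub_clamp_pow_le (x : ℝ) {K : ℝ} (hK : 1 ≤ K) {d : ℕ} (hd : 1 ≤ d) :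
    |x ^ d - (max (-K) (min K x)) ^ d| ≤ 2 / K * x ^ (2 * d) := by
  have hx2 : x ^ (2 * d) = |x| ^ d * |x| ^ d := by
    rw [← pow_add, ← two_mul, (even_two_mul d).pow_abs]
  by_cases hx : |x| ≤ K
  · obtain ⟨h1, h2⟩ := abs_le.1 hx
    rw [min_eq_right h2, max_eq_right h1, sub_self, abs_zero, hx2]
    positivity
  · push Not at hx
    have hc : |max (-K) (min K x)| ≤ |x| := by
      refine (abs_le.2 ⟨le_max_left _ _, max_le (by linarith) (min_le_left _ _)⟩).trans hx.le
    have h1 : K ≤ |x| ^ d := hx.le.trans (le_self_pow₀ (hK.trans hx.le) (by omega))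
    calc |x ^ d - (max (-K) (min K x)) ^ d|
        ≤ |x ^ d| + |(max (-K) (min K x)) ^ d| := abs_sub _ _
      _ ≤ |x| ^ d + |x| ^ d := by
        rw [abs_pow, abs_pow]
        gcongr
      _ = 2 / K * (K * |x| ^ d) := by field_simp; ring
      _ ≤ 2 / K * (|x| ^ d * |x| ^ d) := by gcongr
      _ = _ := by rw [hx2]

lemma integral_even_pow_le {μ : Measure ℝ}
    (h : ∀ t : ℝ, Integrable (fun x ↦ Real.exp (t * x)) μ) (d : ℕ) :
    ∫ x, x ^ (2 * d) ∂μ ≤ (2 * d).factorial *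
      (∫ x, Real.exp (1 * x) ∂μ + ∫ x, Real.exp (-1 * x) ∂μ) := by
  rw [← integral_add (h 1) (h (-1)), ← integral_const_mul]
  refine integral_mono (integrable_pow_of_integrable_exp h _) (((h 1).add (h (-1))).const_mul _)
    fun x ↦ ?_
  have h1 := Real.pow_div_factorial_le_exp |x| (abs_nonneg x) (2 * d)
  rw [(even_two_mul d).pow_abs, div_le_iff₀' (by positivity)] at h1
  refine h1.trans ?_
  gcongr
  simpa using Real.exp_abs_le x

/-- Weak convergence together with uniform bounds on moment generating functions implies
convergence of moments. -/
lemma tendsto_integral_pow_of_tendsto {μs : ℕ → ProbabilityMeasure ℝ} {μ : ProbabilityMeasure ℝ}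
    (hμ : Tendsto μs atTop (𝓝 μ)) {C : ℝ → ℝ}
    (hint : ∀ n t, Integrable (fun x ↦ Real.exp (t * x)) (μs n : Measure ℝ))
    (hC : ∀ n t, ∫ x, Real.exp (t * x) ∂(μs n : Measure ℝ) ≤ C t) {d : ℕ} (hd : 1 ≤ d) :
    Tendsto (fun n ↦ ∫ x, x ^ d ∂(μs n : Measure ℝ)) atTop
      (𝓝 (∫ x, x ^ d ∂(μ : Measure ℝ))) := by
  set B : ℝ := (2 * d).factorial * (C 1 + C (-1)) with hB
  have happrox (ν : ProbabilityMeasure ℝ)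
      (hν : ∀ t : ℝ, Integrable (fun x ↦ Real.exp (t * x)) (ν : Measure ℝ))
      (hνC : ∀ t, ∫ x, Real.exp (t * x) ∂(ν : Measure ℝ) ≤ C t) (K : ℝ) (hK : 1 ≤ K)
      (g : BoundedContinuousFunction ℝ ℝ) (hg : ∀ x, g x = (max (-K) (min K x)) ^ d) :
      |∫ x, x ^ d ∂(ν : Measure ℝ) - ∫ x, g x ∂(ν : Measure ℝ)| ≤ 2 / K * B := by
    rw [← integral_sub (integrable_pow_of_integrable_exp hν d) (g.integrable _)]
    calc _ ≤ ∫ x, |x ^ d - g x| ∂(ν : Measure ℝ) := abs_integral_le_integral_abs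
      _ ≤ ∫ x, 2 / K * x ^ (2 * d) ∂(ν : Measure ℝ) := by
        refine integral_mono ((integrable_pow_of_integrable_exp hν d).sub (g.integrable _)).abs
          ((integrable_pow_of_integrable_exp hν _).const_mul _) fun x ↦ ?_
        simp only [hg]
        exact abs_pow_sub_clamp_pow_le x hK hd
      _ ≤ 2 / K * B := by
        rw [integral_const_mul]
        gcongr
        refine (integral_even_pow_le hν d).trans ?_
        rw [hB]
        gcongr <;> apply hνC
  have hB0 : 0 ≤ B := by
    have h1 : 0 ≤ C 1 := (integral_nonneg fun x ↦ (Real.exp_pos _).le).trans (hC 0 1)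
    have h2 : 0 ≤ C (-1) := (integral_nonneg fun x ↦ (Real.exp_pos _).le).trans (hC 0 (-1))
    positivity
  rw [Metric.tendsto_atTop]
  intro ε hε
  -- One third of `ε` for each of the two truncation errors, one for weak convergence of the
  -- truncated power.
  obtain ⟨K, hK, hKε⟩ : ∃ K : ℝ, 1 ≤ K ∧ 2 / K * B < ε / 3 := by
    refine ⟨1 + 6 * B / ε, by simp; positivity, ?_⟩
    have : 0 < 1 + 6 * B / ε := by positivity
    rw [div_mul_eq_mul_div, div_lt_iff₀ this]
    field_simp
    linarith
  let g : BoundedContinuousFunction ℝ ℝ := BoundedContinuousFunction.ofNormedAddCommGroup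
    (fun x ↦ (max (-K) (min K x)) ^ d) (by fun_prop) (K ^ d) fun x ↦ by
      rw [norm_pow]
      gcongr
      exact abs_le.2 ⟨le_max_left _ _, max_le (by linarith) (min_le_left _ _)⟩
  have hg : ∀ x, g x = (max (-K) (min K x)) ^ d := fun x ↦ rfl
  have hlim := ProbabilityMeasure.tendsto_iff_forall_integral_tendsto.1 hμ g
  obtain ⟨N, hN⟩ := Metric.tendsto_atTop.1 hlim (ε / 3) (by positivity)
  refine ⟨N, fun n hn ↦ ?_⟩
  have h1 := happrox (μs n) (hint n) (hC n) K hK g hg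
  have h2 := happrox μ (fun t ↦ (integrable_exp_of_tendsto hμ hint hC t).1)
    (fun t ↦ (integrable_exp_of_tendsto hμ hint hC t).2) K hK g hg
  have h3 := hN n hn
  rw [Real.dist_eq] at h3 ⊢
  rw [abs_le] at h1 h2
  rw [abs_lt] at h3 ⊢
  constructor <;> linarith [h1.1, h1.2, h2.1, h2.2, h3.1, h3.2]

/-! ### Products of factors `1 + w * u` -/

lemma eval_prod_one_add_facts (w : Multiset ℝ) (hw : ∀ x ∈ w, 1 ≤ x) :
    (w.map fun a ↦ 1 + C a * X).prod.eval 0 = 1 ∧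
      (derivative (w.map fun a ↦ 1 + C a * X).prod).eval 0 = w.sum ∧
      ∀ u : ℝ, 0 ≤ u → 0 ≤ (w.map fun a ↦ 1 + C a * X).prod.eval u ∧
        (w.map fun a ↦ 1 + C a * X).prod.eval u ≤ Real.exp (w.sum * u) := by
  induction w using Multiset.induction_on with
  | empty => simp
  | cons a w ih =>
    obtain ⟨h1, h2, h3⟩ := ih fun x hx ↦ hw x (Multiset.mem_cons_of_mem hx)
    have ha : 1 ≤ a := hw a (Multiset.mem_cons_self a w)
    refine ⟨by simp [h1], by simp [h1, h2, derivative_mul], fun u hu ↦ ?_⟩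
    obtain ⟨h4, h5⟩ := h3 u hu
    have h6 : 0 ≤ 1 + a * u := by positivity
    simp only [Multiset.map_cons, Multiset.prod_cons, Multiset.sum_cons, eval_mul, eval_add,
      eval_one, eval_C, eval_X]
    rw [add_mul a, Real.exp_add]
    refine ⟨mul_nonneg h6 h4, ?_⟩
    gcongr
    linarith [Real.add_one_le_exp (a * u)]

/-- Both sides equal `e ^ s * (2 * cosh s - 2 * Re z)`, as `2 * cosh s - 2 = 4 * sinh (s / 2) ^ 2`.
-/
lemma norm_exp_sub_sq {z : ℂ} (hz : ‖z‖ = 1) (s : ℝ) :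
    ‖(Real.exp s : ℂ) - z‖ ^ 2 = Real.exp s * (‖1 - z‖ ^ 2 + 4 * Real.sinh (s / 2) ^ 2) := by
  have hn : z.re * z.re + z.im * z.im = 1 := by
    rw [← Complex.normSq_apply, Complex.normSq_eq_norm_sq, hz, one_pow]
  have hs : Real.exp s = Real.exp (s / 2) ^ 2 := by
    rw [← Real.exp_nat_mul]
    congr 1
    push_cast
    ring
  have hinv : Real.exp (s / 2) * Real.exp (-(s / 2)) = 1 := by
    rw [← Real.exp_add, add_neg_cancel, Real.exp_zero]
  rw [Complex.sq_norm, Complex.sq_norm, Complex.normSq_apply, Complex.normSq_apply,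
    Real.sinh_eq, hs]
  simp only [Complex.sub_re, Complex.sub_im, Complex.ofReal_re, Complex.ofReal_im,
    Complex.one_re, Complex.one_im]
  generalize Real.exp (s / 2) = a at *
  generalize Real.exp (-(s / 2)) = b at *
  linear_combination (1 - a ^ 2) * hn + (2 * a ^ 2 - a * b - 1) * hinv

/-- For complex numbers that are zero or on the unit circle, but different from one, the products
`∏ |e ^ s - z| ^ 2` factor into an exponential and factors `1 + w * sinh (s / 2) ^ 2`. -/
lemma exists_prod_norm_exp_sub_sq (R : Multiset ℂ) (hR : ∀ z ∈ R, z = 0 ∨ ‖z‖ = 1 ∧ z ≠ 1) :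
    ∃ (c : ℝ) (w : Multiset ℝ), (∀ x ∈ w, 1 ≤ x) ∧ ∀ s : ℝ,
      ‖(R.map fun z ↦ (Real.exp s : ℂ) - z).prod‖ ^ 2 =
        ‖(R.map fun z ↦ 1 - z).prod‖ ^ 2 * (Real.exp (2 * (s * c)) *
          (w.map fun a ↦ 1 + C a * X).prod.eval (Real.sinh (s / 2) ^ 2)) := by
  induction R using Multiset.induction_on with
  | empty => exact ⟨0, 0, by simp, by simp⟩
  | cons z R ih =>
    obtain ⟨c, w, hw, h⟩ := ih fun x hx ↦ hR x (Multiset.mem_cons_of_mem hx)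
    obtain rfl | ⟨hz, hz1⟩ := hR z (Multiset.mem_cons_self z R)
    · refine ⟨c + 1, w, hw, fun s ↦ ?_⟩
      simp only [Multiset.map_cons, Multiset.prod_cons, norm_mul, mul_pow, h, sub_zero,
        mul_add, Real.exp_add, mul_one, Complex.norm_real, Real.norm_eq_abs, Real.abs_exp,
        one_mul, two_mul]
      ring
    · have h1z : 0 < ‖1 - z‖ := norm_pos_iff.2 (sub_ne_zero.2 hz1.symm)
      refine ⟨c + 1 / 2, (4 / ‖1 - z‖ ^ 2) ::ₘ w, ?_, fun s ↦ ?_⟩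
      · intro x hx
        obtain rfl | hx := Multiset.mem_cons.1 hx
        · rw [le_div_iff₀ (by positivity)]
          have : ‖1 - z‖ ≤ 2 := (norm_sub_le _ _).trans (by rw [hz, norm_one]; norm_num)
          nlinarith
        · exact hw x hx
      · have he : Real.exp (2 * (s * (c + 1 / 2))) = Real.exp s * Real.exp (2 * (s * c)) := by
          rw [← Real.exp_add]
          congr 1
          ring
        simp only [Multiset.map_cons, Multiset.prod_cons, norm_mul, mul_pow, h,
          norm_exp_sub_sq hz, eval_mul, eval_add, eval_one, eval_C, eval_X, he]
        field_simp

/-! ### Factorization and the first two moments -/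

lemma IsCyclotomicGeneratingFunction.eval_one_pos {f : ℕ[X]}
    (hf : IsCyclotomicGeneratingFunction f) : 0 < f.eval 1 := by
  rw [eval_eq_sum, sum_def]
  obtain ⟨k, hk⟩ := nonempty_support_iff.2 hf.1
  refine Finset.sum_pos (fun k hk ↦ ?_) ⟨k, hk⟩
  simpa using Nat.pos_of_ne_zero (mem_support_iff.1 hk)

/-- Product formula for the square of the normalized values of a cyclotomic generating function
at `e ^ s`. -/
lemma IsCyclotomicGeneratingFunction.exists_eval_exp_sq {f : ℕ[X]}
    (hf : IsCyclotomicGeneratingFunction f) :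
    ∃ (c : ℝ) (w : Multiset ℝ), (∀ x ∈ w, 1 ≤ x) ∧ ∀ s : ℝ,
      (∑ k ∈ f.support, (f.coeff k : ℝ) / (f.eval 1 : ℕ) * Real.exp (s * (k - c))) ^ 2 =
        (w.map fun a ↦ 1 + C a * X).prod.eval (Real.sinh (s / 2) ^ 2) := by
  set g : ℂ[X] := f.map (Nat.castRingHom ℂ) with hg
  have hN := hf.eval_one_pos
  have hg1 : g.eval 1 = (f.eval 1 : ℕ) := by
    rw [hg, ← map_one (Nat.castRingHom ℂ), eval_map_apply]
    simp
  have hroot : ∀ z ∈ g.roots, z = 0 ∨ ‖z‖ = 1 ∧ z ≠ 1 := by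
    intro z hz
    have hz0 : g.eval z = 0 := (mem_roots'.1 hz).2
    have hz' : aeval z f = 0 := by
      rw [aeval_def, ← eval_map]
      exact hz0
    refine (hf.2 z hz').imp id fun ⟨m, hm, hzm⟩ ↦ ⟨Complex.norm_eq_one_of_pow_eq_one hzm hm.ne', ?_⟩
    rintro rfl
    rw [hg1] at hz0
    exact hN.ne' (by exact_mod_cast hz0)
  obtain ⟨c, w, hw, h⟩ := exists_prod_norm_exp_sub_sq g.roots hroot
  refine ⟨c, w, hw, fun s ↦ ?_⟩
  have hsp := IsAlgClosed.splits g
  have e1 : ‖g.eval (Real.exp s : ℂ)‖ ^ 2 = ‖g.eval 1‖ ^ 2 * (Real.exp (2 * (s * c)) *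
      (w.map fun a ↦ 1 + C a * X).prod.eval (Real.sinh (s / 2) ^ 2)) := by
    rw [hsp.eval_eq_prod_roots, hsp.eval_eq_prod_roots, norm_mul, norm_mul, mul_pow, mul_pow, h s]
    ring
  have e2 : g.eval (Real.exp s : ℂ) = ((∑ k ∈ f.support, (f.coeff k : ℝ) * Real.exp (s * k) : ℝ) : ℂ)
      := by
    rw [hg, eval_map, eval₂_eq_sum, sum_def]
    push_cast
    refine Finset.sum_congr rfl fun k _ ↦ ?_
    rw [← Complex.exp_nat_mul, mul_comm (k : ℂ)]
  have hNR : ((f.eval 1 : ℕ) : ℝ) ≠ 0 := by exact_mod_cast hN.ne'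
  rw [e2, hg1, Complex.norm_real, Real.norm_eq_abs, sq_abs, Complex.norm_natCast] at e1
  have e3 : ∑ k ∈ f.support, (f.coeff k : ℝ) / (f.eval 1 : ℕ) * Real.exp (s * (k - c)) =
      (∑ k ∈ f.support, (f.coeff k : ℝ) * Real.exp (s * k)) / (f.eval 1 : ℕ) *
        Real.exp (-(s * c)) := by
    rw [Finset.sum_div, Finset.sum_mul]
    refine Finset.sum_congr rfl fun k _ ↦ ?_
    rw [mul_sub, sub_eq_add_neg, Real.exp_add]
    ring
  have e4 : Real.exp (2 * (s * c)) * Real.exp (-(s * c)) ^ 2 = 1 := by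
    rw [← Real.exp_nat_mul, ← Real.exp_add, ← Real.exp_zero]
    congr 1
    push_cast
    ring
  rw [e3, mul_pow, div_pow, e1, mul_div_cancel_left₀ _ (by positivity), mul_right_comm, e4,
    one_mul]

/-- If the square of an exponential sum is a product of factors `1 + w * sinh (s / 2) ^ 2`, then
its first two derivatives at zero are `0` and `(∑ w) / 4`. -/
lemma expSum_moments {ι : Type*} (S : Finset ι) (p a : ι → ℝ) (P : ℝ[X]) (hp : ∑ i ∈ S, p i = 1)
    (h : ∀ s : ℝ, (∑ i ∈ S, p i * Real.exp (s * a i)) ^ 2 = P.eval (Real.sinh (s / 2) ^ 2)) :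
    ∑ i ∈ S, p i * a i = 0 ∧ ∑ i ∈ S, p i * a i ^ 2 = (derivative P).eval 0 / 4 := by
  have hexp (q : ι → ℝ) (s : ℝ) : HasDerivAt (fun s ↦ ∑ i ∈ S, q i * Real.exp (s * a i))
      (∑ i ∈ S, (q i * a i) * Real.exp (s * a i)) s := by
    refine HasDerivAt.fun_sum fun i _ ↦ ?_
    have := ((hasDerivAt_mul_const (x := s) (a i)).exp).const_mul (q i)
    convert! this using 1
    ring
  have hh (s : ℝ) : HasDerivAt (fun s : ℝ ↦ Real.sinh (s / 2) ^ 2) (Real.sinh s / 2) s := by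
    have := (((hasDerivAt_id s).div_const 2).sinh).pow 2
    convert! this using 1
    have h2 := Real.sinh_two_mul (s / 2)
    rw [mul_div_cancel₀ _ two_ne_zero] at h2
    simp only [id, h2]
    ring
  have hP (Q : ℝ[X]) (s : ℝ) : HasDerivAt (fun s : ℝ ↦ Q.eval (Real.sinh (s / 2) ^ 2))
      ((derivative Q).eval (Real.sinh (s / 2) ^ 2) * (Real.sinh s / 2)) s :=
    (Q.hasDerivAt _).comp s (hh s)
  have hfirst (s : ℝ) : 2 * (∑ i ∈ S, p i * Real.exp (s * a i)) *
      (∑ i ∈ S, (p i * a i) * Real.exp (s * a i)) =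
      (derivative P).eval (Real.sinh (s / 2) ^ 2) * (Real.sinh s / 2) := by
    have h1 := (hexp p s).fun_pow 2
    rw [funext h] at h1
    have := h1.unique (hP P s)
    rw [← this]
    norm_num
  have h1 : ∑ i ∈ S, p i * a i = 0 := by
    have := hfirst 0
    simpa [hp] using this
  refine ⟨h1, ?_⟩
  -- With `F` the exponential sum, differentiating `2 * F * F'` at 0, where `F = 1` and `F' = 0`,
  -- gives `2 * F'' = P'(0) / 2`.
  have h2 := ((hexp p 0).const_mul 2).fun_mul (hexp (fun i ↦ p i * a i) 0)
  rw [funext hfirst] at h2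
  have := h2.unique ((hP (derivative P) 0).fun_mul ((Real.hasDerivAt_sinh 0).div_const 2))
  simp only [zero_mul, Real.exp_zero, mul_one, hp, h1, Real.sinh_zero, zero_div, mul_zero,
    zero_add, Real.cosh_zero, ne_eq, OfNat.ofNat_ne_zero, not_false_eq_true, zero_pow] at this
  have h3 : ∑ i ∈ S, p i * a i ^ 2 = ∑ i ∈ S, p i * a i * a i :=
    Finset.sum_congr rfl fun i _ ↦ by ring
  rw [h3]
  linarith

/-! ### Random variables corresponding to polynomials -/

section

variable {Ω : Type*} [MeasurableSpace Ω] {μ : Measure Ω} [IsProbabilityMeasure μ] {Y : Ω → ℝ}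
  {f : ℕ[X]}

lemma sum_coeff_div_eval_one (hf : 0 < f.eval 1) :
    ∑ k ∈ f.support, (f.coeff k : ℝ) / (f.eval 1 : ℕ) = 1 := by
  rw [← Finset.sum_div, div_eq_one_iff_eq (by exact_mod_cast hf.ne')]
  rw [eval_eq_sum, sum_def]
  simp

/-- The prescribed masses sum to one, so the law lives on the finite support of `f`. -/
lemma CorrespondsTo.expectation (h : CorrespondsTo Y f μ) (hf : 0 < f.eval 1) {g : ℝ → ℝ}
    (hg : Continuous g) :
    Integrable (fun ω ↦ g (Y ω)) μ ∧
      ∫ ω, g (Y ω) ∂μ = ∑ k ∈ f.support, (f.coeff k : ℝ) / (f.eval 1 : ℕ) * g k := by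
  obtain ⟨hY, h⟩ := h
  set ν := μ.map Y
  have : IsProbabilityMeasure ν := Measure.isProbabilityMeasure_map hY
  have hν (k : ℕ) : ν.real {(k : ℝ)} = (f.coeff k : ℝ) / (f.eval 1 : ℕ) := by
    rw [← h k, map_measureReal_apply_of_aemeasurable hY (measurableSet_singleton _)]
    rfl
  set T : Finset ℝ := f.support.map Nat.castEmbedding
  have hT : ν.real T = 1 := by
    rw [← sum_measureReal_singleton, Finset.sum_map, ← sum_coeff_div_eval_one hf]
    exact Finset.sum_congr rfl fun k _ ↦ hν k
  have hae : ∀ᵐ x ∂ν, x ∈ (T : Set ℝ) := by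
    rw [measureReal_def, ENNReal.toReal_eq_one_iff] at hT
    filter_upwards [(mem_ae_iff_prob_eq_one T.measurableSet).2 hT] with x hx using hx
  have hres : ν.restrict T = ν := Measure.restrict_eq_self_of_ae_mem hae
  have hint : Integrable g ν := by
    rw [← hres]
    exact hg.continuousOn.integrableOn_compact T.finite_toSet.isCompact
  refine ⟨hint.comp_aemeasurable hY, ?_⟩
  rw [← integral_map hY hg.aestronglyMeasurable]
  change ∫ x, g x ∂ν = _
  rw [← hres, setIntegral_finset (s := T) (by rwa [IntegrableOn, hres]), Finset.sum_map]
  refine Finset.sum_congr rfl fun k _ ↦ ?_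
  rw [← hν k]
  rfl

/-- The variance `v` of a random variable corresponding to a cyclotomic generating function is
zero or at least `1 / 4`, and it controls the centered moment generating function. -/
lemma CorrespondsTo.centered_mgf (h : CorrespondsTo Y f μ)
    (hf : IsCyclotomicGeneratingFunction f) :
    (variance Y μ = 0 ∨ 1 / 4 ≤ variance Y μ) ∧ ∀ s : ℝ,
      Integrable (fun ω ↦ Real.exp (s * (Y ω - ∫ ω', Y ω' ∂μ))) μ ∧
        ∫ ω, Real.exp (s * (Y ω - ∫ ω', Y ω' ∂μ)) ∂μ ≤
          Real.exp (2 * variance Y μ * Real.sinh (s / 2) ^ 2) := by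
  have hN := hf.eval_one_pos
  have hsum := sum_coeff_div_eval_one hN
  obtain ⟨c, w, hw, hsq⟩ := hf.exists_eval_exp_sq
  obtain ⟨-, hP', hPle⟩ := eval_prod_one_add_facts w hw
  -- The vanishing first moment identifies `c` as the mean; the second moment is then the variance.
  obtain ⟨hm1, hm2⟩ := expSum_moments _ _ (fun k : ℕ ↦ (k : ℝ) - c) _ hsum hsq
  have hmean : ∫ ω, Y ω ∂μ = c := by
    have := (h.expectation hN continuous_id).2
    simp only [mul_sub, Finset.sum_sub_distrib, ← Finset.sum_mul, hsum, id] at hm1 this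
    linarith
  have hvar : variance Y μ = w.sum / 4 := by
    rw [variance_eq_integral h.1, hmean, (h.expectation hN (g := fun x ↦ (x - c) ^ 2)
      (by fun_prop)).2, hm2, hP']
  have hsum0 : 0 ≤ w.sum := Multiset.sum_nonneg fun x hx ↦ zero_le_one.trans (hw x hx)
  rw [hmean, hvar]
  refine ⟨?_, fun s ↦ ?_⟩
  · induction w using Multiset.induction_on with
    | empty => simp
    | cons a w _ =>
      right
      have h1 : 1 ≤ a := hw a (Multiset.mem_cons_self a w)
      have h2 : 0 ≤ w.sum := Multiset.sum_nonneg fun x hx ↦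
        zero_le_one.trans (hw x (Multiset.mem_cons_of_mem hx))
      rw [Multiset.sum_cons]
      linarith
  · obtain ⟨h1, h2⟩ := h.expectation hN (g := fun x ↦ Real.exp (s * (x - c))) (by fun_prop)
    refine ⟨h1, ?_⟩
    rw [h2]
    refine le_of_sq_le_sq ?_ (Real.exp_pos _).le
    rw [hsq s, ← Real.exp_nat_mul]
    refine (hPle _ (sq_nonneg _)).2.trans (Real.exp_le_exp.2 (le_of_eq ?_))
    push_cast
    ring

/-- For `y ≥ 0`, `sinh y = e ^ y * (1 - e ^ (-2 * y)) / 2` and `1 - e ^ (-2 * y) ≤ 2 * y`. -/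
lemma Real.abs_sinh_le (y : ℝ) : |Real.sinh y| ≤ |y| * Real.exp |y| := by
  wlog hy : 0 ≤ y generalizing y
  · simpa using this (-y) (by linarith)
  rw [abs_of_nonneg hy, abs_of_nonneg (Real.sinh_nonneg_iff.2 hy), Real.sinh_eq]
  have h1 := Real.add_one_le_exp (-(2 * y))
  have h2 : Real.exp (-y) = Real.exp y * Real.exp (-(2 * y)) := by
    rw [← Real.exp_add]
    congr 1
    ring
  rw [h2]
  nlinarith [Real.exp_pos y]

/-- Uniform bound for the moment generating function of the standardization of a random variable
corresponding to a cyclotomic generating function. -/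
lemma CorrespondsTo.standardize_mgf (h : CorrespondsTo Y f μ)
    (hf : IsCyclotomicGeneratingFunction f) (t : ℝ) :
    Integrable (fun ω ↦ Real.exp (t * standardize Y μ ω)) μ ∧
      ∫ ω, Real.exp (t * standardize Y μ ω) ∂μ ≤
        Real.exp (t ^ 2 / 2 * Real.exp (2 * |t|)) := by
  obtain ⟨hv, hs⟩ := h.centered_mgf hf
  obtain hv | hv := hv
  · simp only [standardize, hv, Real.sqrt_zero, div_zero, mul_zero, Real.exp_zero]
    refine ⟨integrable_const _, ?_⟩
    simp only [integral_const, probReal_univ, smul_eq_mul, mul_one]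
    exact Real.one_le_exp (by positivity)
  · set v := variance Y μ
    have hσ : 1 / 2 ≤ √v := Real.le_sqrt_of_sq_le (by norm_num; linarith)
    have hσ2 : √v ^ 2 = v := Real.sq_sqrt (by linarith)
    have heq : (fun ω ↦ Real.exp (t * standardize Y μ ω)) =
        fun ω ↦ Real.exp (t / √v * (Y ω - ∫ ω', Y ω' ∂μ)) := by
      funext ω
      simp only [standardize, v]
      congr 1
      ring
    rw [heq]
    refine ⟨(hs _).1, (hs _).2.trans (Real.exp_le_exp.2 ?_)⟩
    -- The gap `√v ≥ 1 / 2` makes the bound independent of the variance.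
    have hy : |t / √v / 2| ≤ |t| := by
      rw [abs_div, abs_div, abs_of_pos (by linarith : 0 < √v), abs_two, div_div]
      exact div_le_self (abs_nonneg t) (by linarith)
    calc 2 * v * Real.sinh (t / √v / 2) ^ 2
        ≤ 2 * v * (|t / √v / 2| * Real.exp |t / √v / 2|) ^ 2 := by
          rw [← sq_abs (Real.sinh _)]
          gcongr
          exact Real.abs_sinh_le _
      _ = t ^ 2 / 2 * Real.exp |t / √v / 2| ^ 2 := by
          rw [mul_pow, sq_abs, div_pow, div_pow, hσ2]
          field_simp
      _ ≤ t ^ 2 / 2 * Real.exp |t| ^ 2 := by gcongr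
      _ = _ := by
          rw [← Real.exp_nat_mul]
          norm_num

end

theorem theorem5p2 {Ω : ℕ → Type*} [∀ n, MeasurableSpace (Ω n)] (P : ∀ n, Measure (Ω n))
    [∀ n, IsProbabilityMeasure (P n)] {Ω' : Type*} [MeasurableSpace Ω'] (P' : Measure Ω')
    [IsProbabilityMeasure P'] (f : ℕ → ℕ[X]) (X : ∀ n, Ω n → ℝ) (Z : Ω' → ℝ)
    (hf : ∀ n, IsCyclotomicGeneratingFunction (f n))
    (hX : ∀ n, CorrespondsTo (X n) (f n) (P n))
    (hZ : TendstoInDistribution (fun n ↦ standardize (X n) (P n)) atTop Z P P') :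
    IsDeterminedByMoments Z P' ∧
      ∀ d : ℕ, 1 ≤ d →
        Tendsto (fun n ↦ moment (standardize (X n) (P n)) d (P n)) atTop (𝓝 (moment Z d P')) := by
  obtain ⟨hm, hmZ, hlim⟩ := hZ
  have hint (n : ℕ) (t : ℝ) : Integrable (fun x ↦ Real.exp (t * x))
      ((P n).map (standardize (X n) (P n))) :=
    (integrable_map_measure (by fun_prop) (hm n)).2 ((hX n).standardize_mgf (hf n) t).1
  have hC (n : ℕ) (t : ℝ) : ∫ x, Real.exp (t * x) ∂((P n).map (standardize (X n) (P n))) ≤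
      Real.exp (t ^ 2 / 2 * Real.exp (2 * |t|)) := by
    rw [integral_map (hm n) (by fun_prop)]
    exact ((hX n).standardize_mgf (hf n) t).2
  have hZint (t : ℝ) : Integrable (fun x ↦ Real.exp (t * x)) (P'.map Z) :=
    (integrable_exp_of_tendsto hlim hint hC t).1
  have := Measure.isProbabilityMeasure_map hmZ
  refine ⟨⟨fun d ↦ (integrable_map_measure (g := fun x ↦ x ^ d) (by fun_prop) hmZ).1
    (integrable_pow_of_integrable_exp hZint d), fun ν _ hνm ↦ ?_⟩, fun d hd ↦ ?_⟩
  · refine eq_of_moments_eq_of_integrable_exp hZint (fun d ↦ (hνm d).1) fun d ↦ ?_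
    rw [(hνm d).2]
    exact (integral_map (f := fun x ↦ x ^ d) hmZ (by fun_prop)).symm
  · have := tendsto_integral_pow_of_tendsto hlim hint hC hd
    simp only [ProbabilityMeasure.coe_mk] at this
    rw [integral_map (f := fun x ↦ x ^ d) hmZ (by fun_prop)] at this
    refine this.congr fun n ↦ ?_
    exact integral_map (f := fun x ↦ x ^ d) (hm n) (by fun_prop)
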